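/- Theorem (Test function slope). Let $(X,d)$ be a Hadamard space (a complete CAT(0) metric space), let $A\subset X$ be a nonempty finite set, and let $\bar x\in X\setminus A$. Define the test function $f_{A,\bar x}\colon X\to\mathbb{R}$ by $$f_{A,\bar x}(x)=\tfrac12\max_{a\in A}\{d(x,a)^2-d(\bar x,a)^2\},$$ and the mean deficit of $A$ at $\bar x$ by $$\mathrm{def}_A(\bar x)=\Big(\sup_{y\ne\bar x}\ \min_{a\in A}\{d(\bar x,a)\cos\angle a\bar xy\}\Big)^+,$$ where $\alpha^+=\max\{\alpha,0\}$ and $\angle a\bar xy$ is the Alexandrov angle at $\bar x$ between the geodesics from $\bar x$ to $a$ and from $\bar x$ to $y$. For a function $f\colon X\to\mathbb{R}$, let the slope $|\nabla f|(\bar x)$ be $0$ if $\bar x$ is a local minimizer of $f$, and $\limsup_{x\to\bar x,\,x\neq\bar x}\frac{f(\bar x)-f(x)}{d(\bar x,x)}$ otherwise. Then $$|\nabla f_{A,\bar x}|(\bar x)\ \ge\ \mathrm{def}_A(\bar x).$$ If, moreover, $X$ is locally compact and has the geodesic extension property (every local geodesic $[a,b]\to X$ with $a<b$ extends to a local geodesic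 $[a,b+\varepsilon]\to X$ for some $\varepsilon>0$), then $$|\nabla f_{A,\bar x}|(\bar x)=\mathrm{def}_A(\bar x),$$ and the supremum over $y\ne\bar x$ in the definition of $\mathrm{def}_A(\bar x)$ is attained. -/

import Mathlib

open Filter Topology Set

noncomputable section

namespace Hadamard

variable {X : Type*} [MetricSpace X]

/-- `c` restricted to the compact interval `[a, b]` is an isometry into `X`. -/
def IsIsometricOn (c : ℝ → X) (a b : ℝ) : Prop :=
  ∀ s ∈ Icc a b, ∀ t ∈ Icc a b, dist (c s) (c t) = |s - t|

/-- `c` restricted to `[0, d(x,y)]` is a (unit speed) geodesic from `x` to `y`. -/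
structure IsGeodesicFromTo (c : ℝ → X) (x y : X) : Prop where
  start : c 0 = x
  finish : c (dist x y) = y
  isometric : IsIsometricOn c 0 (dist x y)

/-- `c` restricted to `[a, b]` is a local geodesic: each parameter `t ∈ [a, b]` has a
neighbourhood in `[a, b]` on which `c` is an isometry. -/
def IsLocalGeodesicOn (c : ℝ → X) (a b : ℝ) : Prop :=
  ∀ t ∈ Icc a b, ∃ ε > 0, ∀ s ∈ Icc a b, ∀ s' ∈ Icc a b,
    |t - s| < ε → |t - s'| < ε → dist (c s) (c s') = |s - s'|

variable (X) in
/-- Every two points are joined by a geodesic. -/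
def IsGeodesicSpace : Prop :=
  ∀ x y : X, ∃ c : ℝ → X, IsGeodesicFromTo c x y

/-- The Euclidean plane, in which comparison triangles live. -/
abbrev Plane : Type := EuclideanSpace ℝ (Fin 2)

/-- `p', q', r'` are the vertices of a comparison triangle for `p, q, r`. -/
structure IsComparisonTriangle (p q r : X) (p' q' r' : Plane) : Prop where
  dist_pq : dist p' q' = dist p q
  dist_qr : dist q' r' = dist q r
  dist_rp : dist r' p' = dist r p

variable (X) in
/-- A CAT(0) space: a geodesic space in which distances between points on the sides of a geodesic
triangle are no larger than the corresponding distances in a comparison triangle.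
Two different sides share a vertex, called `p` here, and can be parametrized starting from it;
`c s` and `c' t` are arbitrary points on these sides, `x'` and `y'` their comparison points.
(For two points on one side the distances agree.) -/
structure IsCAT0 : Prop where
  geodesic : IsGeodesicSpace X
  comparison : ∀ (p q r : X) (c c' : ℝ → X),
    IsGeodesicFromTo c p q → IsGeodesicFromTo c' p r →
    ∀ p' q' r' : Plane, IsComparisonTriangle p q r p' q' r' →
    ∀ s ∈ Icc 0 (dist p q), ∀ t ∈ Icc 0 (dist p r),
    ∀ x' ∈ segment ℝ p' q', ∀ y' ∈ segment ℝ p' r',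
    dist p' x' = s → dist p' y' = t →
    dist (c s) (c' t) ≤ dist x' y'

variable (X) in
/-- A Hadamard space is a complete CAT(0) space. -/
structure IsHadamardSpace : Prop where
  cat0 : IsCAT0 X
  complete : CompleteSpace X

variable (X) in
/-- The geodesic extension property: every nonconstant local geodesic `[a, b] → X` extends to a
local geodesic on a strictly larger interval `[a, b + ε]`. -/
def GeodesicExtensionProperty : Prop :=
  ∀ (c : ℝ → X) (a b : ℝ), a < b → IsLocalGeodesicOn c a b →
    ∃ ε > 0, ∃ c' : ℝ → X, IsLocalGeodesicOn c' a (b + ε) ∧ EqOn c' c (Icc a b)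

/-- The comparison angle at `p` between `x` and `y`: the angle at `p'` in a Euclidean comparison
triangle, given by the law of cosines (for `x ≠ p ≠ y`). -/
def comparisonAngle (p x y : X) : ℝ :=
  Real.arccos ((dist p x ^ 2 + dist p y ^ 2 - dist x y ^ 2) / (2 * dist p x * dist p y))

/-- The Alexandrov angle between two geodesics issuing from the same point `c 0 = c' 0`. -/
def alexandrovAngle (c c' : ℝ → X) : ℝ :=
  limsup (fun s : ℝ × ℝ => comparisonAngle (c 0) (c s.1) (c' s.2)) (𝓝[>] 0 ×ˢ 𝓝[>] 0)

open Classical in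
/-- The geodesic from `x` to `y` (if there is one; it is unique on `[0, d(x,y)]` in a CAT(0) space,
see `IsGeodesicFromTo.unique`). -/
def geodesic (x y : X) : ℝ → X :=
  if h : ∃ c : ℝ → X, IsGeodesicFromTo c x y then h.choose else fun _ => x

theorem geodesic_spec (hX : IsGeodesicSpace X) (x y : X) :
    IsGeodesicFromTo (geodesic x y) x y := by
  have h := hX x y
  rw [geodesic, dif_pos h]
  exact h.choose_spec

/-- Geodesics in CAT(0) spaces are unique. -/
theorem IsGeodesicFromTo.unique (hX : IsCAT0 X) {x y : X} {c c' : ℝ → X}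
    (hc : IsGeodesicFromTo c x y) (hc' : IsGeodesicFromTo c' x y) :
    EqOn c c' (Icc 0 (dist x y)) := by
  intro s hs
  have key : ∀ u : ℝ, dist (0 : Plane) (EuclideanSpace.single 0 u) = |u| := by
    intro u
    simp [EuclideanSpace.dist_eq, Real.sqrt_sq_eq_abs]
  have hmem : (EuclideanSpace.single 0 s : Plane) ∈
      segment ℝ (0 : Plane) (EuclideanSpace.single 0 (dist x y)) := by
    rw [segment_eq_image]
    refine ⟨s / dist x y, ⟨div_nonneg hs.1 dist_nonneg, div_le_one_of_le₀ hs.2 dist_nonneg⟩, ?_⟩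
    rcases eq_or_ne (dist x y) 0 with h | h
    · have : s = 0 := le_antisymm (h ▸ hs.2) hs.1
      ext i
      simp [this]
    · ext i
      fin_cases i <;> simp [h]
  have hd : dist (0 : Plane) (EuclideanSpace.single 0 s) = s := by rw [key, abs_of_nonneg hs.1]
  have h := hX.comparison x y y c c' hc hc' 0 (EuclideanSpace.single 0 (dist x y))
    (EuclideanSpace.single 0 (dist x y))
    ⟨by rw [key, abs_of_nonneg dist_nonneg], by simp,
      by rw [dist_comm, key, abs_of_nonneg dist_nonneg, dist_comm]⟩
    s hs s hs _ hmem _ hmem hd hd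
  rw [dist_self] at h
  exact dist_le_zero.1 h

/-- The angle `∠ a x y` at `x` between the geodesics from `x` to `a` and from `x` to `y`. -/
def angle (a x y : X) : ℝ :=
  alexandrovAngle (geodesic x a) (geodesic x y)

/-- The test function `f_{A,x̄}(x) = ½ max_{a ∈ A} (d(x,a)² - d(x̄,a)²)`. -/
def testFunction (A : Finset X) (hA : A.Nonempty) (xbar : X) (x : X) : ℝ :=
  (1 / 2) * A.sup' hA (fun a => dist x a ^ 2 - dist xbar a ^ 2)

open Classical in
/-- The metric slope of `f` at `xbar`, as an extended real number: the limit superior of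
`(f xbar - f x) / d(xbar, x)` as `x → xbar`, `x ≠ xbar`, unless `xbar` is a local minimizer, in
which case it is zero. -/
def slope (f : X → ℝ) (xbar : X) : EReal :=
  if IsLocalMin f xbar then 0
  else limsup (fun x => (((f xbar - f x) / dist xbar x : ℝ) : EReal)) (𝓝[≠] xbar)

/-- `min_{a ∈ A} d(x,a) cos ∠ a x y`. -/
def directionalDeficit (A : Finset X) (hA : A.Nonempty) (x y : X) : ℝ :=
  A.inf' hA (fun a => dist x a * Real.cos (angle a x y))

/-- The mean deficit
`def_A(x) = (sup_{y ≠ x} min_{a ∈ A} d(x,a) cos ∠ a x y)⁺`, for `x ∉ A`.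
(The set is then nonempty, and it is bounded because `|cos| ≤ 1`.) -/
def meanDeficit (A : Finset X) (hA : A.Nonempty) (x : X) : ℝ :=
  max (sSup (directionalDeficit A hA x '' {y | y ≠ x})) 0

end Hadamard

end

/-! Write x for the base point. Everything rests on two estimates for d(·,a)². The law of cosines
inequality `IsCAT0.le_dist_sq` bounds the difference quotient of the test function at every u ≠ x by
the directional deficit towards u, so the slope is at most the mean deficit
(`IsCAT0.slope_le_meanDeficit`). Conversely, the first variation formula
`IsCAT0.tendsto_dist_sub_div` shows that moving along the geodesic towards y achieves, in the limit,
a quotient no smaller than the directional deficit of y (`IsCAT0.meanDeficit_le_slope`).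

For attainment, angles depend only on germs of geodesics. Extending or shortening geodesics
therefore moves every direction to a small sphere (`IsCAT0.exists_mem_sphere_forall_angle_eq`),
which is compact, and on it the directional deficit is continuous by `IsCAT0.abs_cos_angle_sub_le`.
-/

namespace Hadamard

/-! ### Comparison triangles and the law of cosines -/

section Comparison

variable {X : Type*} [MetricSpace X]

/-- The cosine of the comparison angle at `p` between `x` and `y`. -/
noncomputable def cosComparisonAngle (p x y : X) : ℝ :=
  (dist p x ^ 2 + dist p y ^ 2 - dist x y ^ 2) / (2 * dist p x * dist p y)

theorem comparisonAngle_eq_arccos (p x y : X) :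
    comparisonAngle p x y = Real.arccos (cosComparisonAngle p x y) := rfl

theorem two_mul_cosComparisonAngle {p x y : X} (hx : x ≠ p) (hy : y ≠ p) :
    2 * dist p x * dist p y * cosComparisonAngle p x y =
      dist p x ^ 2 + dist p y ^ 2 - dist x y ^ 2 := by
  have h1 := dist_pos.2 hx.symm
  have h2 := dist_pos.2 hy.symm
  unfold cosComparisonAngle
  field_simp

theorem cosComparisonAngle_le_one {p x y : X} (hx : x ≠ p) (hy : y ≠ p) :
    cosComparisonAngle p x y ≤ 1 := by
  have h1 := dist_pos.2 hx.symm
  have h2 := dist_pos.2 hy.symm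
  unfold cosComparisonAngle
  rw [div_le_one (by positivity)]
  have := abs_dist_sub_le x y p
  rw [dist_comm x p, dist_comm y p] at this
  nlinarith [sq_le_sq.2 (this.trans (le_abs_self _))]

theorem neg_one_le_cosComparisonAngle {p x y : X} (hx : x ≠ p) (hy : y ≠ p) :
    -1 ≤ cosComparisonAngle p x y := by
  have h1 := dist_pos.2 hx.symm
  have h2 := dist_pos.2 hy.symm
  unfold cosComparisonAngle
  rw [le_div_iff₀ (by positivity)]
  have := dist_triangle x p y
  rw [dist_comm x p] at this
  nlinarith [@dist_nonneg _ _ x y]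

theorem comparisonAngle_nonneg (p x y : X) : 0 ≤ comparisonAngle p x y := Real.arccos_nonneg _

theorem comparisonAngle_le_pi (p x y : X) : comparisonAngle p x y ≤ Real.pi := Real.arccos_le_pi _

theorem dist_sq_plane_polar {u v K : ℝ} (hK : K ^ 2 ≤ 1) :
    dist (!₂[u, 0] : Plane) !₂[v * K, v * √(1 - K ^ 2)] ^ 2 =
      u ^ 2 + v ^ 2 - 2 * u * v * K := by
  rw [EuclideanSpace.dist_eq, Real.sq_sqrt (by positivity), Fin.sum_univ_two]
  simp only [Real.dist_eq, sq_abs]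
  simp
  rw [mul_pow, Real.sq_sqrt (by linarith)]
  ring

theorem mem_segment_zero_of_eq_smul {E : Type*} [AddCommGroup E] [Module ℝ E] {v w : E} {θ : ℝ}
    (h0 : 0 ≤ θ) (h1 : θ ≤ 1) (h : w = θ • v) : w ∈ segment ℝ 0 v := by
  rw [segment_eq_image]
  exact ⟨θ, ⟨h0, h1⟩, by simp [h]⟩

/-- The CAT(0) inequality in the form of a law of cosines. -/
theorem IsCAT0.dist_sq_le (hX : IsCAT0 X) {p q r : X} {c c' : ℝ → X}
    (hc : IsGeodesicFromTo c p q) (hc' : IsGeodesicFromTo c' p r) (hq : q ≠ p) (hr : r ≠ p)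
    {s t : ℝ} (hs : s ∈ Icc 0 (dist p q)) (ht : t ∈ Icc 0 (dist p r)) :
    dist (c s) (c' t) ^ 2 ≤ s ^ 2 + t ^ 2 - 2 * s * t * cosComparisonAngle p q r := by
  have hq0 := dist_pos.2 hq.symm
  have hr0 := dist_pos.2 hr.symm
  have hm := two_mul_cosComparisonAngle hq hr
  set K := cosComparisonAngle p q r with hKdef
  have hK1 : K ≤ 1 := cosComparisonAngle_le_one hq hr
  have hK2 : -1 ≤ K := neg_one_le_cosComparisonAngle hq hr
  have hK : K ^ 2 ≤ 1 := by nlinarith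
  have hz : (0 : Plane) = !₂[(0 : ℝ), 0] := by ext i; fin_cases i <;> simp
  have e1 : ∀ u : ℝ, 0 ≤ u → dist (0 : Plane) !₂[u, 0] = u := by
    intro u hu
    simp [EuclideanSpace.dist_eq, Fin.sum_univ_two, Real.sqrt_sq hu]
  have e2 : ∀ v : ℝ, 0 ≤ v → dist (0 : Plane) !₂[v * K, v * √(1 - K ^ 2)] = v := by
    intro v hv
    rw [hz, ← sq_eq_sq₀ dist_nonneg hv, dist_sq_plane_polar hK]
    ring
  -- The comparison triangle is placed with `p` at the origin, `q` on the first axis and `r` at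
  -- polar angle arccos `K`.
  have e3 : dist (!₂[dist p q, 0] : Plane) !₂[dist p r * K, dist p r * √(1 - K ^ 2)] =
      dist q r := by
    rw [← sq_eq_sq₀ dist_nonneg dist_nonneg, dist_sq_plane_polar hK]
    linarith
  have m1 : (!₂[s, 0] : Plane) ∈ segment ℝ 0 !₂[dist p q, 0] := by
    refine mem_segment_zero_of_eq_smul (div_nonneg hs.1 hq0.le)
      (div_le_one_of_le₀ hs.2 hq0.le) ?_
    ext i; fin_cases i <;> simp [hq0.ne']
  have m2 : (!₂[t * K, t * √(1 - K ^ 2)] : Plane) ∈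
      segment ℝ 0 !₂[dist p r * K, dist p r * √(1 - K ^ 2)] := by
    refine mem_segment_zero_of_eq_smul (div_nonneg ht.1 hr0.le)
      (div_le_one_of_le₀ ht.2 hr0.le) ?_
    ext i; fin_cases i <;> simp <;> field_simp
  have key := hX.comparison p q r c c' hc hc' 0 _ _
    ⟨e1 _ hq0.le, e3, by rw [dist_comm, e2 _ hr0.le, dist_comm]⟩
    s hs t ht _ m1 _ m2 (e1 _ hs.1) (e2 _ ht.1)
  rw [← dist_sq_plane_polar hK]
  exact pow_le_pow_left₀ dist_nonneg key 2

theorem IsGeodesicFromTo.dist_start {c : ℝ → X} {x y : X} (hc : IsGeodesicFromTo c x y) {t : ℝ}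
    (ht : t ∈ Icc 0 (dist x y)) : dist x (c t) = t := by
  have := hc.isometric 0 ⟨le_rfl, dist_nonneg⟩ t ht
  rwa [hc.start, zero_sub, abs_neg, abs_of_nonneg ht.1] at this

theorem IsGeodesicFromTo.dist_finish {c : ℝ → X} {x y : X} (hc : IsGeodesicFromTo c x y) {t : ℝ}
    (ht : t ∈ Icc 0 (dist x y)) : dist (c t) y = dist x y - t := by
  have := hc.isometric t ht _ ⟨dist_nonneg, le_rfl⟩
  rwa [hc.finish, abs_sub_comm, abs_of_nonneg (sub_nonneg.2 ht.2)] at this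

theorem IsGeodesicFromTo.ne_start {c : ℝ → X} {x y : X} (hc : IsGeodesicFromTo c x y) {t : ℝ}
    (h0 : 0 < t) (ht : t ≤ dist x y) : c t ≠ x := by
  rw [ne_comm, ← dist_pos, hc.dist_start ⟨h0.le, ht⟩]
  exact h0

theorem IsGeodesicFromTo.tendsto_start {c : ℝ → X} {x y : X} (hc : IsGeodesicFromTo c x y)
    (hy : y ≠ x) : Tendsto c (𝓝[>] 0) (𝓝[≠] x) := by
  have hev : ∀ᶠ t in 𝓝[>] (0 : ℝ), t ∈ Ioc 0 (dist x y) := Ioc_mem_nhdsGT (dist_pos.2 hy.symm)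
  refine tendsto_nhdsWithin_iff.2 ⟨?_, hev.mono fun t ht => hc.ne_start ht.1 ht.2⟩
  rw [tendsto_iff_dist_tendsto_zero]
  have h : Tendsto (fun t : ℝ => t) (𝓝[>] 0) (𝓝 0) := tendsto_nhdsWithin_of_tendsto_nhds tendsto_id
  refine h.congr' (hev.mono fun t ht => ?_)
  simp only [dist_comm _ x, hc.dist_start ⟨ht.1.le, ht.2⟩]

/-- Comparison angles in a CAT(0) space decrease along geodesics towards the common vertex. -/
theorem IsCAT0.cosComparisonAngle_le (hX : IsCAT0 X) {p q r : X} {c c' : ℝ → X}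
    (hc : IsGeodesicFromTo c p q) (hc' : IsGeodesicFromTo c' p r)
    {s t : ℝ} (hs : s ∈ Ioc 0 (dist p q)) (ht : t ∈ Ioc 0 (dist p r)) :
    cosComparisonAngle p q r ≤ cosComparisonAngle p (c s) (c' t) := by
  have hq : q ≠ p := (dist_pos.1 (hs.1.trans_le hs.2)).symm
  have hr : r ≠ p := (dist_pos.1 (ht.1.trans_le ht.2)).symm
  have hs' := Ioc_subset_Icc_self hs
  have ht' := Ioc_subset_Icc_self ht
  have h := hX.dist_sq_le hc hc' hq hr hs' ht'
  have h1 : 0 < 2 * s * t := by have := hs.1; have := ht.1; positivity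
  rw [cosComparisonAngle.eq_1 p (c s), hc.dist_start hs', hc'.dist_start ht', le_div_iff₀ h1]
  linarith

/-- A geodesic to a point `v` runs through each point `u` between its ends. -/
theorem IsCAT0.eqOn_of_dist_add (hX : IsCAT0 X) {x u v : X} {c c' : ℝ → X}
    (hc : IsGeodesicFromTo c x u) (hc' : IsGeodesicFromTo c' x v) (hu : u ≠ x)
    (h : dist x u + dist u v = dist x v) : EqOn c c' (Icc 0 (dist x u)) := by
  intro t ht
  have hle : dist x u ≤ dist x v := h ▸ le_add_of_nonneg_right dist_nonneg
  have hv : v ≠ x := (dist_pos.1 ((dist_pos.2 hu.symm).trans_le hle)).symm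
  have h1 := hX.dist_sq_le hc hc' hu hv ht ⟨ht.1, ht.2.trans hle⟩
  -- The comparison triangle is degenerate, so the bound on the squared distance at equal parameters
  -- becomes t² + t² - 2t² = 0.
  have hK : cosComparisonAngle x u v = 1 := by
    have h2 := two_mul_cosComparisonAngle hu hv
    have h3 : 0 < 2 * dist x u * dist x v := by
      have := dist_pos.2 hu.symm
      have := dist_pos.2 hv.symm
      positivity
    refine mul_left_cancel₀ h3.ne' (h2.trans ?_)
    rw [← h]
    ring
  rw [hK] at h1
  exact dist_le_zero.1 (by nlinarith [@dist_nonneg _ _ (c t) (c' t)])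

end Comparison

/-! ### Alexandrov angles and the first variation formula -/

section Angle

variable {X : Type*} [MetricSpace X]

theorem alexandrovAngle_congr {c c₁ c₂ : ℝ → X} {ρ : ℝ} (hρ : 0 < ρ)
    (h : EqOn c₁ c₂ (Icc 0 ρ)) : alexandrovAngle c c₁ = alexandrovAngle c c₂ := by
  have hev : ∀ᶠ t in 𝓝[>] (0 : ℝ), c₁ t = c₂ t :=
    mem_of_superset (Ioc_mem_nhdsGT hρ) fun t ht => h (Ioc_subset_Icc_self ht)
  refine limsup_congr ?_
  filter_upwards [hev.prod_inr (𝓝[>] (0 : ℝ))] with s hs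
  rw [hs]

theorem alexandrovAngle_nonneg (c c' : ℝ → X) : 0 ≤ alexandrovAngle c c' :=
  le_limsup_of_frequently_le (Frequently.of_forall fun _ => comparisonAngle_nonneg _ _ _)
    (isBoundedUnder_of ⟨Real.pi, fun _ => comparisonAngle_le_pi _ _ _⟩)

theorem isCoboundedUnder_comparisonAngle (c c' : ℝ → X) :
    IsCoboundedUnder (· ≤ ·) (𝓝[>] (0 : ℝ) ×ˢ 𝓝[>] (0 : ℝ))
      (fun s : ℝ × ℝ => comparisonAngle (c 0) (c s.1) (c' s.2)) :=
  (isBoundedUnder_of (r := (· ≥ ·))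
    ⟨0, fun _ => comparisonAngle_nonneg _ _ _⟩).isCoboundedUnder_le

theorem alexandrovAngle_le_pi (c c' : ℝ → X) : alexandrovAngle c c' ≤ Real.pi :=
  limsup_le_of_le (isCoboundedUnder_comparisonAngle c c')
    (Eventually.of_forall fun _ => comparisonAngle_le_pi _ _ _)

/-- In a CAT(0) space Alexandrov angles are at most the comparison angles. -/
theorem IsCAT0.cosComparisonAngle_le_cos_angle (hX : IsCAT0 X) {a x y : X} (ha : a ≠ x)
    (hy : y ≠ x) : cosComparisonAngle x a y ≤ Real.cos (angle a x y) := by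
  have hca := geodesic_spec hX.geodesic x a
  have hcy := geodesic_spec hX.geodesic x y
  have hle : angle a x y ≤ comparisonAngle x a y := by
    refine limsup_le_of_le (isCoboundedUnder_comparisonAngle _ _) ?_
    filter_upwards [prod_mem_prod (Ioc_mem_nhdsGT (dist_pos.2 ha.symm))
      (Ioc_mem_nhdsGT (dist_pos.2 hy.symm))] with s hs
    rw [hca.start]
    exact Real.arccos_le_arccos (hX.cosComparisonAngle_le hca hcy hs.1 hs.2)
  rw [← Real.cos_arccos (neg_one_le_cosComparisonAngle ha hy) (cosComparisonAngle_le_one ha hy)]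
  exact Real.cos_le_cos_of_nonneg_of_le_pi (alexandrovAngle_nonneg _ _) (Real.arccos_le_pi _) hle

/-- The law of cosines inequality for Alexandrov angles in a CAT(0) space. -/
theorem IsCAT0.le_dist_sq (hX : IsCAT0 X) {a x y : X} (ha : a ≠ x) (hy : y ≠ x) :
    dist x a ^ 2 + dist x y ^ 2 - 2 * dist x a * dist x y * Real.cos (angle a x y) ≤
      dist y a ^ 2 := by
  have h1 := two_mul_cosComparisonAngle ha hy
  have h2 := mul_le_mul_of_nonneg_left (hX.cosComparisonAngle_le_cos_angle ha hy)
    (show 0 ≤ 2 * dist x a * dist x y by positivity)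
  rw [dist_comm y a]
  linarith

theorem IsCAT0.angle_eq_of_dist_add (hX : IsCAT0 X) (a : X) {x u v : X} (hu : u ≠ x)
    (h : dist x u + dist u v = dist x v) : angle a x u = angle a x v :=
  alexandrovAngle_congr (dist_pos.2 hu.symm) (hX.eqOn_of_dist_add
    (geodesic_spec hX.geodesic x u) (geodesic_spec hX.geodesic x v) hu h)

theorem IsGeodesicSpace.eventually_lt_cosComparisonAngle (hX : IsGeodesicSpace X) {a x y : X}
    (ha : a ≠ x) (hy : y ≠ x) {κ : ℝ} (hκ : κ < Real.cos (angle a x y)) :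
    ∀ᶠ s : ℝ × ℝ in 𝓝[>] 0 ×ˢ 𝓝[>] 0,
      κ < cosComparisonAngle x (Hadamard.geodesic x a s.1) (Hadamard.geodesic x y s.2) := by
  have hca := geodesic_spec hX x a
  have hcy := geodesic_spec hX x y
  have hev := prod_mem_prod (Ioc_mem_nhdsGT (dist_pos.2 ha.symm))
      (Ioc_mem_nhdsGT (dist_pos.2 hy.symm))
  -- `Real.arccos` is constant below -1, so strict monotonicity is available only for κ ≥ -1.
  rcases lt_or_ge κ (-1) with h1 | h1
  · filter_upwards [hev] with s hs
    exact h1.trans_le (neg_one_le_cosComparisonAngle (hca.ne_start hs.1.1 hs.1.2)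
      (hcy.ne_start hs.2.1 hs.2.2))
  have hlt : angle a x y < Real.arccos κ := by
    rw [← Real.arccos_cos (x := angle a x y) (alexandrovAngle_nonneg _ _)
      (alexandrovAngle_le_pi _ _)]
    exact Real.strictAntiOn_arccos ⟨h1, hκ.le.trans (Real.cos_le_one _)⟩
      ⟨Real.neg_one_le_cos _, Real.cos_le_one _⟩ hκ
  have := eventually_lt_of_limsup_lt hlt
    (isBoundedUnder_of ⟨Real.pi, fun _ => comparisonAngle_le_pi _ _ _⟩)
  filter_upwards [this] with s hs
  rw [hca.start, comparisonAngle_eq_arccos] at hs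
  by_contra hcon
  exact absurd hs (not_lt.2 (Real.arccos_le_arccos (not_lt.1 hcon)))

/-- Freeze a point at parameter s on the geodesic to `a`. The angle bounds its distance to the
moving point, and the triangle inequality through it gives the bound on the distance to `a`. -/
theorem IsGeodesicSpace.eventually_dist_le (hX : IsGeodesicSpace X) {a x y : X}
    (ha : a ≠ x) (hy : y ≠ x) {m : ℝ} (hm : m < Real.cos (angle a x y)) :
    ∀ᶠ t in 𝓝[>] (0 : ℝ), dist (Hadamard.geodesic x y t) a ≤ dist x a - t * m := by
  have hca := geodesic_spec hX x a
  have hcy := geodesic_spec hX x y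
  obtain ⟨κ, hmκ, hκ⟩ := exists_between hm
  obtain ⟨P, hP, Q, hQ, hPQ⟩ :=
    eventually_prod_iff.1 (hX.eventually_lt_cosComparisonAngle ha hy hκ)
  obtain ⟨s, hs, hs0, hsa⟩ := (hP.and (Ioc_mem_nhdsGT (dist_pos.2 ha.symm))).exists
  -- t ≤ 2s(κ - m) gives s² + t² - 2stκ ≤ (s - tm)², and t ≤ s with m ≤ 1 keeps s - tm nonnegative.
  have hρ : 0 < min (dist x y) (min s (2 * s * (κ - m))) :=
    lt_min (dist_pos.2 hy.symm) (lt_min hs0 (mul_pos (by positivity) (sub_pos.2 hmκ)))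
  filter_upwards [hQ, Ioc_mem_nhdsGT hρ] with t htQ ht
  obtain ⟨ht0, ht⟩ := ht
  simp only [le_min_iff] at ht
  obtain ⟨hty, hts, htm⟩ := ht
  have hK := hPQ hs htQ
  have h1 := two_mul_cosComparisonAngle (hca.ne_start hs0 hsa) (hcy.ne_start ht0 hty)
  rw [hca.dist_start ⟨hs0.le, hsa⟩, hcy.dist_start ⟨ht0.le, hty⟩] at h1
  have h2 := mul_lt_mul_of_pos_left hK (show 0 < 2 * s * t by positivity)
  have hm1 : m ≤ 1 := hm.le.trans (Real.cos_le_one _)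
  have h3 : dist (Hadamard.geodesic x a s) (Hadamard.geodesic x y t) ≤ s - t * m := by
    refine abs_le_of_sq_le_sq' ?_ ?_ |>.2
    · nlinarith [mul_le_mul_of_nonneg_left htm ht0.le, sq_nonneg (t * m)]
    · nlinarith
  have h4 := dist_triangle_left (Hadamard.geodesic x y t) a (Hadamard.geodesic x a s)
  rw [hca.dist_finish ⟨hs0.le, hsa⟩] at h4
  linarith

/-- The first variation formula in CAT(0) spaces. -/
theorem IsCAT0.tendsto_dist_sub_div (hX : IsCAT0 X) {a x y : X} (ha : a ≠ x) (hy : y ≠ x) :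
    Tendsto (fun t => (dist x a - dist (Hadamard.geodesic x y t) a) / t) (𝓝[>] 0)
      (𝓝 (Real.cos (angle a x y))) := by
  have hcy := geodesic_spec hX.geodesic x y
  refine tendsto_order.2 ⟨fun m hm => ?_, fun m hm => ?_⟩
  · obtain ⟨m', hm', hm''⟩ := exists_between hm
    filter_upwards [hX.geodesic.eventually_dist_le ha hy hm'', self_mem_nhdsWithin] with t ht ht0
    have ht0 : 0 < t := ht0
    refine hm'.trans_le ((le_div_iff₀ ht0).2 ?_)
    linarith
  · filter_upwards [Ioc_mem_nhdsGT (dist_pos.2 hy.symm)] with t ht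
    refine lt_of_le_of_lt ((div_le_iff₀ ht.1).2 ?_) hm
    have ht' := Ioc_subset_Icc_self ht
    have hne := hcy.ne_start ht.1 ht.2
    have h1 := hX.le_dist_sq ha hne
    rw [hX.angle_eq_of_dist_add a (v := y) hne
      (by rw [hcy.dist_start ht', hcy.dist_finish ht']; ring), hcy.dist_start ht'] at h1
    -- Since cos² ≤ 1, the law of cosines bound dominates (d(x,a) - t cos)².
    have h2 : dist x a - t * Real.cos (angle a x y) ≤ dist (Hadamard.geodesic x y t) a := by
      refine abs_le_of_sq_le_sq' ?_ dist_nonneg |>.2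
      nlinarith [Real.cos_sq_le_one (angle a x y), sq_nonneg t]
    linarith

/-- By first variation the difference of cosines is a limit of quotients bounded by the distance
between the two moving points over t, and CAT(0) bounds that ratio by its value at t = r. -/
theorem IsCAT0.abs_cos_angle_sub_le (hX : IsCAT0 X) {a x y z : X} {r : ℝ} (hr : 0 < r)
    (ha : a ≠ x) (hy : dist x y = r) (hz : dist x z = r) :
    |Real.cos (angle a x y) - Real.cos (angle a x z)| ≤ dist y z / r := by
  have hy0 : y ≠ x := (dist_pos.1 (hy ▸ hr)).symm
  have hz0 : z ≠ x := (dist_pos.1 (hz ▸ hr)).symm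
  refine le_of_tendsto ((hX.tendsto_dist_sub_div ha hy0).sub
    (hX.tendsto_dist_sub_div ha hz0)).abs ?_
  filter_upwards [Ioc_mem_nhdsGT hr] with t ht
  have ht0 := ht.1
  have h1 := hX.dist_sq_le (geodesic_spec hX.geodesic x y) (geodesic_spec hX.geodesic x z) hy0 hz0
    (s := t) (t := t) (hy ▸ Ioc_subset_Icc_self ht) (hz ▸ Ioc_subset_Icc_self ht)
  have h2 := two_mul_cosComparisonAngle hy0 hz0
  rw [hy, hz] at h2
  have h3 : dist (Hadamard.geodesic x y t) (Hadamard.geodesic x z t) ≤ t * (dist y z / r) := by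
    refine abs_le_of_sq_le_sq' (h1.trans_eq ?_) (by positivity) |>.2
    have : dist y z ^ 2 = 2 * r ^ 2 * (1 - cosComparisonAngle x y z) := by linarith
    rw [mul_pow, div_pow, this]
    field_simp
    ring
  rw [← sub_div, abs_div, abs_of_pos ht0, div_le_iff₀ ht0, mul_comm]
  refine le_trans (le_of_eq_of_le ?_ (abs_dist_sub_le (Hadamard.geodesic x y t) (Hadamard.geodesic x z t) a)) h3
  rw [abs_sub_comm]
  congr 1
  ring

end Angle

end Hadamard
namespace Hadamard

/-! ### Prolonging geodesics to a sphere -/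

section Extension

variable {X : Type*} [MetricSpace X]

/-- A short piece of the extension straddling `z` is straight. Comparison angles shrink towards the
vertex, so the large triangle also has comparison angle π at `z`, which makes the distances add. -/
theorem IsCAT0.exists_dist_add_of_extension (hX : IsCAT0 X) (hE : GeodesicExtensionProperty X)
    {x z : X} (hz : z ≠ x) {ρ : ℝ} (hρ : 0 < ρ) :
    ∃ z', 0 < dist z z' ∧ dist z z' ≤ ρ ∧ dist x z + dist z z' = dist x z' := by
  have hT := dist_pos.2 hz.symm
  have hc := geodesic_spec hX.geodesic x z
  obtain ⟨e, he, c, hloc, heq⟩ := hE (Hadamard.geodesic x z) 0 (dist x z) hT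
    fun t _ => ⟨1, one_pos, fun s hs s' hs' _ _ => hc.isometric s hs s' hs'⟩
  set T := dist x z
  have hiso : IsIsometricOn c 0 T := fun s hs t ht => by
    rw [heq hs, heq ht, hc.isometric s hs t ht]
  have h0 : c 0 = x := by rw [heq ⟨le_rfl, hT.le⟩, hc.start]
  have h1 : c T = z := by rw [heq ⟨hT.le, le_rfl⟩, hc.finish]
  obtain ⟨ε, hε, hloc⟩ := hloc T ⟨hT.le, by linarith⟩
  set δ := min (ε / 2) T with hδ
  set η := min (ε / 2) (min e ρ) with hη
  have hδ0 : 0 < δ := lt_min (by linarith) hT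
  have hη0 : 0 < η := lt_min (by linarith) (lt_min he hρ)
  have hδε : δ ≤ ε / 2 := min_le_left _ _
  have hδT : δ ≤ T := min_le_right _ _
  have hηε : η ≤ ε / 2 := min_le_left _ _
  have hηe : η ≤ e := (min_le_right _ _).trans (min_le_left _ _)
  have hηρ : η ≤ ρ := (min_le_right _ _).trans (min_le_right _ _)
  have hzv : dist z (c (T + η)) = η := by
    rw [← h1, hloc T ⟨hT.le, by linarith⟩ (T + η) ⟨by linarith, by linarith⟩ (by simpa)
      (by rw [abs_lt]; constructor <;> linarith), sub_add_cancel_left, abs_neg, abs_of_pos hη0]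
  have huv : dist (c (T - δ)) (c (T + η)) = δ + η := by
    rw [hloc (T - δ) ⟨by linarith, by linarith⟩ (T + η) ⟨by linarith, by linarith⟩
      (by rw [abs_lt]; constructor <;> linarith) (by rw [abs_lt]; constructor <;> linarith),
      abs_of_neg (by linarith)]
    ring
  have hrev : IsGeodesicFromTo (fun s => c (T - s)) z x := by
    have hzx : dist z x = T := dist_comm z x
    refine ⟨by simpa, by simpa [hzx], fun s hs t ht => ?_⟩
    rw [hzx] at hs ht
    rw [hiso _ ⟨by linarith [hs.2], by linarith [hs.1]⟩ _ ⟨by linarith [ht.2], by linarith [ht.1]⟩,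
      abs_sub_comm]
    congr 1
    ring
  have hv : c (T + η) ≠ z := (dist_pos.1 (hη0.trans_eq hzv.symm)).symm
  have hgv := geodesic_spec hX.geodesic z (c (T + η))
  have h2 := hX.dist_sq_le hrev hgv hz.symm hv (s := δ) (t := η)
    ⟨hδ0.le, by rw [dist_comm z x]; exact hδT⟩ ⟨hη0.le, hzv.ge⟩
  have hfin : Hadamard.geodesic z (c (T + η)) η = c (T + η) := by
    have := hgv.finish
    rwa [hzv] at this
  rw [hfin, huv] at h2
  have hK : cosComparisonAngle z x (c (T + η)) ≤ -1 := by
    have h3 : 0 < 2 * δ * η := by positivity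
    by_contra! hcon
    nlinarith [mul_lt_mul_of_pos_left hcon h3]
  have h4 := two_mul_cosComparisonAngle hz.symm hv
  rw [hzv, dist_comm z x, show dist x z = T from rfl] at h4
  have h5 := mul_le_mul_of_nonneg_left hK (show 0 ≤ 2 * T * η by positivity)
  refine ⟨c (T + η), hη0.trans_eq hzv.symm, hzv.trans_le hηρ, le_antisymm ?_ (dist_triangle _ _ _)⟩
  rw [hzv]
  refine abs_le_of_sq_le_sq' ?_ dist_nonneg |>.2
  nlinarith

/-- Each point of a compact ball lies between its centre and a point of the bounding sphere. -/
theorem IsCAT0.exists_dist_eq_radius (hX : IsCAT0 X) (hE : GeodesicExtensionProperty X)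
    {x y : X} (hy : y ≠ x) {r : ℝ} (hc : IsCompact (Metric.closedBall x r)) (hyr : dist x y ≤ r) :
    ∃ z, dist x z = r ∧ dist x y + dist y z = dist x z := by
  set S := Metric.closedBall x r ∩ {z | dist x y + dist y z = dist x z}
  have hS : IsCompact S := hc.inter_right
    (isClosed_eq (by fun_prop) (by fun_prop))
  -- Take the farthest admissible point: inside the open ball it could be prolonged further.
  obtain ⟨z, ⟨hzr, hz⟩, hmax⟩ := hS.exists_isMaxOn (f := fun z => dist x z)
    ⟨y, by rwa [Metric.mem_closedBall, dist_comm], by simp⟩ (by fun_prop)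
  rw [Metric.mem_closedBall, dist_comm] at hzr
  refine ⟨z, hzr.antisymm ?_, hz⟩
  by_contra! hlt
  have hz : dist x y + dist y z = dist x z := hz
  have hzx : z ≠ x := by
    rw [ne_comm, ← dist_pos, ← hz]
    have := dist_pos.2 hy.symm
    positivity
  obtain ⟨z', h0, h1, h2⟩ := hX.exists_dist_add_of_extension hE hzx (sub_pos.2 hlt)
  have h3 : dist x z' ≤ dist x z := hmax ⟨by rw [Metric.mem_closedBall, dist_comm]; linarith, by
    refine le_antisymm ?_ (dist_triangle _ _ _)
    linarith [dist_triangle y z z']⟩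
  linarith

theorem IsCAT0.exists_mem_sphere_forall_angle_eq (hX : IsCAT0 X)
    (hE : GeodesicExtensionProperty X) {x y : X} (hy : y ≠ x) {r : ℝ} (hr : 0 < r)
    (hc : IsCompact (Metric.closedBall x r)) :
    ∃ z ∈ Metric.sphere x r, ∀ a, angle a x y = angle a x z := by
  rcases le_total (dist x y) r with h | h
  · obtain ⟨z, hz, h⟩ := hX.exists_dist_eq_radius hE hy hc h
    exact ⟨z, by rwa [Metric.mem_sphere'],
      fun a => hX.angle_eq_of_dist_add a hy h⟩
  · have hg := geodesic_spec hX.geodesic x y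
    have hmem : r ∈ Icc 0 (dist x y) := ⟨hr.le, h⟩
    refine ⟨Hadamard.geodesic x y r, by rw [Metric.mem_sphere', hg.dist_start hmem],
      fun a => (hX.angle_eq_of_dist_add a (hg.ne_start hr h) ?_).symm⟩
    rw [hg.dist_start hmem, hg.dist_finish hmem]
    ring

end Extension

/-! ### Slope against deficit, and attainment -/

section Deficit

variable {X : Type*} [MetricSpace X]

theorem bddAbove_directionalDeficit (A : Finset X) (hA : A.Nonempty) (x : X) :
    BddAbove (directionalDeficit A hA x '' {y | y ≠ x}) := by
  obtain ⟨a, ha⟩ := hA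
  refine ⟨dist x a, ?_⟩
  rintro _ ⟨y, -, rfl⟩
  exact (Finset.inf'_le _ ha).trans (mul_le_of_le_one_right dist_nonneg (Real.cos_le_one _))

theorem testFunction_self (A : Finset X) (hA : A.Nonempty) (x : X) :
    testFunction A hA x x = 0 := by
  simp [testFunction]

theorem IsCAT0.testFunction_sub_div_le (hX : IsCAT0 X) {A : Finset X} (hA : A.Nonempty) {x u : X}
    (hx : x ∉ A) (hu : u ≠ x) :
    (testFunction A hA x x - testFunction A hA x u) / dist x u ≤ directionalDeficit A hA x u := by
  have hu0 := dist_pos.2 hu.symm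
  refine Finset.le_inf' _ _ fun a ha => ?_
  rw [testFunction_self, div_le_iff₀ hu0]
  have h1 := hX.le_dist_sq (ne_of_mem_of_not_mem ha hx) hu
  have h2 := Finset.le_sup' (fun a => dist u a ^ 2 - dist x a ^ 2) ha
  unfold testFunction
  nlinarith [sq_nonneg (dist x u)]

/-- Factor the difference of squares: the mean of the two distances tends to d(x,a), the remaining
quotient to the cosine. Finiteness of `A` makes the bounds simultaneous. -/
theorem IsCAT0.eventually_lt_testFunction_sub_div (hX : IsCAT0 X) {A : Finset X} (hA : A.Nonempty)
    {x y : X} (hx : x ∉ A) (hy : y ≠ x) {m : ℝ} (hm : m < directionalDeficit A hA x y) :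
    ∀ᶠ u in map (Hadamard.geodesic x y) (𝓝[>] 0),
      m < (testFunction A hA x x - testFunction A hA x u) / dist x u := by
  have hcy := geodesic_spec hX.geodesic x y
  rw [eventually_map]
  have key : ∀ a ∈ A, ∀ᶠ t in 𝓝[>] (0 : ℝ),
      m < (dist x a ^ 2 - dist (Hadamard.geodesic x y t) a ^ 2) / (2 * t) := by
    intro a ha
    have h1 := hX.tendsto_dist_sub_div (ne_of_mem_of_not_mem ha hx) hy
    have h2 : Tendsto (fun t => (dist x a + dist (Hadamard.geodesic x y t) a) / 2) (𝓝[>] 0)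
        (𝓝 ((dist x a + dist x a) / 2)) :=
      ((((hcy.tendsto_start hy).mono_right nhdsWithin_le_nhds).dist
        tendsto_const_nhds).const_add _).div_const _
    have h3 := h2.mul h1
    rw [add_self_div_two] at h3
    have h4 := h3.eventually (lt_mem_nhds (hm.trans_le (Finset.inf'_le _ ha)))
    filter_upwards [h4, self_mem_nhdsWithin] with t ht ht0
    have ht0 : 0 < t := ht0
    refine ht.trans_eq ?_
    field_simp
    ring
  filter_upwards [(eventually_all_finset A).2 key, Ioc_mem_nhdsGT (dist_pos.2 hy.symm)] with t ht ht0
  rw [testFunction_self, hcy.dist_start (Ioc_subset_Icc_self ht0), lt_div_iff₀ ht0.1]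
  have h5 : A.sup' hA (fun a => dist (Hadamard.geodesic x y t) a ^ 2 - dist x a ^ 2) < -(2 * (m * t)) := by
    refine (Finset.sup'_lt_iff hA).2 fun a ha => ?_
    have h6 := ht a ha
    rw [lt_div_iff₀ (by linarith [ht0.1])] at h6
    linarith
  unfold testFunction
  linarith

theorem slope_nonneg (f : X → ℝ) (x : X) : 0 ≤ slope f x := by
  unfold slope
  split_ifs with h
  · exact le_rfl
  have h1 : ∃ᶠ u in 𝓝[≠] x, f u < f x := by
    rw [frequently_nhdsWithin_iff]
    have h2 : ∃ᶠ u in 𝓝 x, ¬ f x ≤ f u := not_eventually.1 h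
    refine h2.mono fun u hu => ⟨not_le.1 hu, ?_⟩
    rintro rfl
    exact hu le_rfl
  refine le_limsup_of_frequently_le (h1.mono fun u hu => ?_)
  exact_mod_cast div_nonneg (sub_nonneg.2 hu.le) dist_nonneg

theorem IsCAT0.directionalDeficit_le_slope (hX : IsCAT0 X) {A : Finset X} (hA : A.Nonempty)
    {x y : X} (hx : x ∉ A) (hy : y ≠ x) :
    ((directionalDeficit A hA x y : ℝ) : EReal) ≤ slope (testFunction A hA x) x := by
  rcases le_or_gt (directionalDeficit A hA x y) 0 with h0 | h0
  -- Only a positive deficit rules out a local minimizer, where the slope is 0 by convention.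
  · exact le_trans (by exact_mod_cast h0) (slope_nonneg _ _)
  have hle : map (Hadamard.geodesic x y) (𝓝[>] 0) ≤ 𝓝[≠] x :=
    (geodesic_spec hX.geodesic x y).tendsto_start hy
  have hnot : ¬ IsLocalMin (testFunction A hA x) x := by
    intro hmin
    obtain ⟨u, hu, hu'⟩ := ((hX.eventually_lt_testFunction_sub_div hA hx hy h0).and
      ((hle.trans nhdsWithin_le_nhds) hmin)).exists
    exact absurd hu (not_lt.2 (div_nonpos_of_nonpos_of_nonneg (sub_nonpos.2 hu') dist_nonneg))
  rw [slope, if_neg hnot]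
  refine le_of_forall_lt fun b hb => ?_
  obtain ⟨m, hbm, hm⟩ := EReal.lt_iff_exists_real_btwn.1 hb
  refine hbm.trans_le (le_limsup_of_frequently_le ?_)
  have h1 := hX.eventually_lt_testFunction_sub_div hA hx hy (EReal.coe_lt_coe_iff.1 hm)
  exact (h1.frequently.filter_mono hle).mono fun u hu => by exact_mod_cast hu.le

theorem IsCAT0.meanDeficit_le_slope (hX : IsCAT0 X) {A : Finset X} (hA : A.Nonempty) {x : X}
    (hx : x ∉ A) : ((meanDeficit A hA x : ℝ) : EReal) ≤ slope (testFunction A hA x) x := by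
  rcases max_choice (sSup (directionalDeficit A hA x '' {y | y ≠ x})) 0 with h | h
  · rw [meanDeficit, h]
    refine le_of_forall_lt fun b hb => ?_
    obtain ⟨m, hbm, hm⟩ := EReal.lt_iff_exists_real_btwn.1 hb
    obtain ⟨a, ha⟩ := id hA
    obtain ⟨_, ⟨y, hy, rfl⟩, hmy⟩ := exists_lt_of_lt_csSup
      ⟨_, mem_image_of_mem _ (ne_of_mem_of_not_mem ha hx)⟩ (EReal.coe_lt_coe_iff.1 hm)
    exact (hbm.trans (EReal.coe_lt_coe_iff.2 hmy)).trans_le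
      (hX.directionalDeficit_le_slope hA hx hy)
  · rw [meanDeficit, h]
    exact slope_nonneg _ _

theorem IsCAT0.slope_le_meanDeficit (hX : IsCAT0 X) {A : Finset X} (hA : A.Nonempty) {x : X}
    (hx : x ∉ A) : slope (testFunction A hA x) x ≤ ((meanDeficit A hA x : ℝ) : EReal) := by
  unfold slope
  split_ifs
  · exact_mod_cast le_max_right _ _
  refine limsup_le_of_le (h := ?_)
  filter_upwards [self_mem_nhdsWithin] with u hu
  refine EReal.coe_le_coe_iff.2 ((hX.testFunction_sub_div_le hA hx hu).trans ?_)
  exact (le_csSup (bddAbove_directionalDeficit A hA x) (mem_image_of_mem _ hu)).trans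
    (le_max_left _ _)

theorem IsCAT0.continuousOn_directionalDeficit (hX : IsCAT0 X) {A : Finset X} (hA : A.Nonempty)
    {x : X} (hx : x ∉ A) {r : ℝ} (hr : 0 < r) :
    ContinuousOn (directionalDeficit A hA x) (Metric.sphere x r) := by
  refine ContinuousOn.finset_inf'_apply hA fun a ha => continuousOn_const.mul ?_
  refine (LipschitzOnWith.of_dist_le_mul (K := ⟨r⁻¹, (inv_pos.2 hr).le⟩)
    fun y hy z hz => ?_).continuousOn
  rw [Metric.mem_sphere'] at hy hz
  rw [Real.dist_eq]
  exact (hX.abs_cos_angle_sub_le hr (ne_of_mem_of_not_mem ha hx) hy hz).trans_eq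
    (div_eq_inv_mul _ _)

theorem IsCAT0.exists_isGreatest_directionalDeficit [LocallyCompactSpace X] (hX : IsCAT0 X)
    (hE : GeodesicExtensionProperty X) {A : Finset X} (hA : A.Nonempty) {x : X} (hx : x ∉ A) :
    ∃ y, y ≠ x ∧ IsGreatest (directionalDeficit A hA x '' {y | y ≠ x})
      (directionalDeficit A hA x y) := by
  obtain ⟨r, hr, hc⟩ := Metric.exists_isCompact_closedBall x
  have key : ∀ y, y ≠ x → ∃ z ∈ Metric.sphere x r,
      directionalDeficit A hA x y = directionalDeficit A hA x z := by
    intro y hy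
    obtain ⟨z, hz, h⟩ := hX.exists_mem_sphere_forall_angle_eq hE hy hr hc
    exact ⟨z, hz, by simp only [directionalDeficit, h]⟩
  obtain ⟨a, ha⟩ := id hA
  -- A point of `A` supplies a direction, so the sphere is nonempty.
  obtain ⟨w, hw, -⟩ := key a (ne_of_mem_of_not_mem ha hx)
  obtain ⟨y, hy, hmax⟩ := (hc.of_isClosed_subset Metric.isClosed_sphere
    Metric.sphere_subset_closedBall).exists_isMaxOn ⟨w, hw⟩
    (hX.continuousOn_directionalDeficit hA hx hr)
  have hyx : y ≠ x := Metric.ne_of_mem_sphere hy hr.ne'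
  refine ⟨y, hyx, mem_image_of_mem _ hyx, ?_⟩
  rintro _ ⟨u, hu, rfl⟩
  obtain ⟨z, hz, h⟩ := key u hu
  exact h.trans_le (hmax hz)

end Deficit

end Hadamard

theorem mainTheorem5 {X : Type*} [MetricSpace X] (hX : Hadamard.IsHadamardSpace X)
    (A : Finset X) (hA : A.Nonempty) (xbar : X) (hxbar : xbar ∉ A) :
    ((Hadamard.meanDeficit A hA xbar : ℝ) : EReal) ≤
        Hadamard.slope (Hadamard.testFunction A hA xbar) xbar ∧
      (LocallyCompactSpace X → Hadamard.GeodesicExtensionProperty X →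
        Hadamard.slope (Hadamard.testFunction A hA xbar) xbar =
            ((Hadamard.meanDeficit A hA xbar : ℝ) : EReal) ∧
          ∃ y, y ≠ xbar ∧
            IsGreatest (Hadamard.directionalDeficit A hA xbar '' {y | y ≠ xbar})
              (Hadamard.directionalDeficit A hA xbar y)) :=
  ⟨hX.cat0.meanDeficit_le_slope hA hxbar, fun _ hE =>
    ⟨(hX.cat0.slope_le_meanDeficit hA hxbar).antisymm (hX.cat0.meanDeficit_le_slope hA hxbar),
      hX.cat0.exists_isGreatest_directionalDeficit hE hA hxbar⟩⟩
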